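/- Let $d\ge 1$, $\mathbb T^d=\mathbb R^d/\mathbb Z^d$, and let $S:\mathbb R^d\times\mathbb R^d\to\mathbb R$ be a generating function: $S$ is $C^2$, $S(x+s,y+s)=S(x,y)$ for all $s\in\mathbb Z^d$, and for some $A>0$ one has $\sum_{i,j}\frac{\partial^2 S}{\partial x_i\partial y_j}(x,y)\,\xi_i\xi_j\le -A\|\xi\|^2$ for all $x,y,\xi\in\mathbb R^d$. Then: * $\mathcal L(x,y)=(x,-\partial_1S(x,y))$ is a bijection from $\mathbb R^d\times\mathbb R^d$ onto $T^*\mathbb R^d=\mathbb R^d\times(\mathbb R^d)^*$; * the lift $\bar F$ of the twist map is the bijection of $T^*\mathbb R^d$ given by $\bar F(x,p)=(x',p')\iff p=-\partial_1S(x,x')$ and $p'=\partial_2S(x,x')$; it induces a diffeomorphism $F$ of $T^*\mathbb T^d=\mathbb T^d\times(\mathbb R^d)^*$; * $\varphi=\mathcal L^{-1}\circ\bar F\circ\mathcal L$, that is, $\varphi(x,y)=(y,z)$ with $\partial_2S(x,y)+\partial_1S(y,z)=0$. Assume that $F$ is without conjugate points: $V(F^n(\omega))\cap DF^n(\omega)V(\omega)=\{0\}$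 for all $\omega\in T^*\mathbb T^d$ and all integers $n\ne0$, where $V(\omega)$ is the kernel at $\omega$ of the differential of the projection $T^*\mathbb T^d\to\mathbb T^d$. For an integer $N\ge1$ and $r\in\mathbb Z^d$ let $$\bar\Gamma_{N,r}=\{(x,y):\varphi^N(x,y)=(x+r,y+r)\},\qquad \bar\Gamma^*_{N,r}=\mathcal L(\bar\Gamma_{N,r}),$$ and let $\Gamma^*_{N,r}$ be the projection of $\bar\Gamma^*_{N,r}$ to $T^*\mathbb T^d$. For $G:\mathbb R^d\times\mathbb R^d\to\mathbb R$ write $G(x_0,\dots,x_n)=\sum_{k<n}G(x_k,x_{k+1})$ and let $\tilde G=\inf\liminf_{n\to\infty}\frac1nG(x_0,\dots,x_n)$, the infimum being over all sequences $(x_k)_{k\in\mathbb N}$ in $\mathbb R^d$. The Aubry set $\bar{\mathcal A}(G)$ is the set of all $(x,y)$ such that for every $\varepsilon>0$ there are $n\ge1$ and $x_0,\dots,x_n\in\mathbb R^d$ with $x_n-x_0\in\mathbb Z^d$, $\|x-x_0\|<\varepsilon$, $\|y-x_1\|<\varepsilon$ and $G(x_0,\dots,x_n)-n\tilde G<\varepsilon$.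 For $c\in H^1(\mathbb T^d,\mathbb R)$ let $\bar{\mathcal A}_c=\bar{\mathcal A}(S_v)$, where $S_v(x,y)=S(x,y)+v(x)-v(y)$ and $v$ is a primitive on $\mathbb R^d$ of the lift of any closed 1-form ($C^1$) on $\mathbb T^d$ in the class $c$; this does not depend on the choices. The dual Aubry set $\mathcal A^*_c$ is the projection to $T^*\mathbb T^d$ of $\mathcal L(\bar{\mathcal A}_c)$. **Proposition.** Let $N\ge1$, $r\in\mathbb Z^d$, and let $u:\mathbb R^d\to\mathbb R$ be a $C^2$ function such that $\bar\Gamma^*_{N,r}$ is the graph $\{(x,Du(x)):x\in\mathbb R^d\}$ of $Du$. Then $Du$ is $\mathbb Z^d$-periodic, so that it induces a closed 1-form on $\mathbb T^d$, and $$\Gamma^*_{N,r}=\mathcal A^*_c,$$ where $c\in H^1(\mathbb T^d,\mathbb R)$ is the cohomology class of that 1-form. -/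

import Mathlib

namespace TwistMap

noncomputable section

/-- `ℝᵈ` with its Euclidean norm. -/
abbrev Space (d : ℕ) : Type := EuclideanSpace ℝ (Fin d)

/-- The dual space `(ℝᵈ)*`. -/
abbrev Covector (d : ℕ) : Type := Space d →L[ℝ] ℝ

/-- The cotangent space `T*ℝᵈ = ℝᵈ × (ℝᵈ)*`. -/
abbrev Cotangent (d : ℕ) : Type := Space d × Covector d

/-- The cotangent bundle `T*𝕋ᵈ = 𝕋ᵈ × (ℝᵈ)*` of the torus `𝕋ᵈ = (ℝ/ℤ)ᵈ`. -/
abbrev TorusCotangent (d : ℕ) : Type := UnitAddTorus (Fin d) × Covector d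

/-- The inclusion of `ℤᵈ` in `ℝᵈ`. -/
def latticeVec {d : ℕ} (r : Fin d → ℤ) : Space d := WithLp.toLp 2 fun i => (r i : ℝ)

/-- The covering `T*ℝᵈ → T*𝕋ᵈ`. -/
def toTorus {d : ℕ} (z : Cotangent d) : TorusCotangent d :=
  (fun i => ((z.1 i : ℝ) : UnitAddCircle), z.2)

/-! ### Generating functions -/

/-- `∂₁S(x,y)`, the differential of `S` with respect to the first variable. -/
def partialOne {d : ℕ} (S : Space d → Space d → ℝ) (x y : Space d) : Covector d :=
  fderiv ℝ (fun x' => S x' y) x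

/-- `∂₂S(x,y)`, the differential of `S` with respect to the second variable. -/
def partialTwo {d : ℕ} (S : Space d → Space d → ℝ) (x y : Space d) : Covector d :=
  fderiv ℝ (fun y' => S x y') y

/-- Generating functions: `C²` functions on `ℝᵈ × ℝᵈ`, invariant under the diagonal action of `ℤᵈ`,
with the uniform twist condition `∑ᵢⱼ ∂²S/∂xᵢ∂yⱼ(x,y) ξᵢ ξⱼ ≤ -A ‖ξ‖²`. -/
structure GeneratingFunction (d : ℕ) where
  toFun : Space d → Space d → ℝ
  contDiff : ContDiff ℝ 2 fun z : Space d × Space d => toFun z.1 z.2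
  periodic : ∀ (r : Fin d → ℤ) (x y : Space d),
    toFun (x + latticeVec r) (y + latticeVec r) = toFun x y
  twist : ∃ A : ℝ, 0 < A ∧ ∀ x y ξ : Space d,
    fderiv ℝ (fun y' => partialOne toFun x y' ξ) y ξ ≤ -A * ‖ξ‖ ^ 2

/-! ### The Legendre maps are bijective -/

/-- A `C¹` map from `ℝᵈ` to its dual whose derivative is uniformly positive is a bijection. -/
theorem bijective_of_fderiv_pos {d : ℕ} {G : Space d → Covector d} (hG : ContDiff ℝ 1 G)
    {A : ℝ} (hA : 0 < A) (h : ∀ y ξ, A * ‖ξ‖ ^ 2 ≤ fderiv ℝ G y ξ ξ) :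
    Function.Bijective G := by
  have hd : Differentiable ℝ G := hG.differentiable (by norm_num)
  have mono : ∀ a b, A * ‖b - a‖ ^ 2 ≤ (G b - G a) (b - a) := by
    intro a b
    let g : ℝ → ℝ := fun t => G (a + t • (b - a)) (b - a) - t * (A * ‖b - a‖ ^ 2)
    have hg : ∀ t, HasDerivAt g
        (fderiv ℝ G (a + t • (b - a)) (b - a) (b - a) - A * ‖b - a‖ ^ 2) t := by
      intro t
      have h1 : HasDerivAt (fun t : ℝ => a + t • (b - a)) (b - a) t := by
        simpa using ((hasDerivAt_id t).smul_const (b - a)).const_add a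
      have h2 := (hd (a + t • (b - a))).hasFDerivAt.comp_hasDerivAt t h1
      have h3 := h2.clm_apply (hasDerivAt_const t (b - a))
      have h4 := (hasDerivAt_id t).mul_const (A * ‖b - a‖ ^ 2)
      have h5 := h3.sub h4
      exact h5.congr_deriv (by simp)
    have hmono : Monotone g := monotone_of_hasDerivAt_nonneg hg fun t => by
      have := h (a + t • (b - a)) (b - a)
      simpa using this
    have := hmono (zero_le_one (α := ℝ))
    simp [g] at this
    simp
    linarith
  have anti : ∀ a b, A * ‖b - a‖ ≤ ‖G b - G a‖ := by
    intro a b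
    rcases eq_or_ne b a with rfl | hne
    · simp
    have hp : 0 < ‖b - a‖ := norm_pos_iff.mpr (sub_ne_zero.mpr hne)
    have h1 : (G b - G a) (b - a) ≤ ‖G b - G a‖ * ‖b - a‖ :=
      (le_abs_self _).trans ((G b - G a).le_opNorm (b - a))
    have h2 := mono a b
    refine le_of_mul_le_mul_right ?_ hp
    nlinarith
  refine ⟨fun a b hab => ?_, ?_⟩
  · have := anti b a
    rw [hab, sub_self, norm_zero] at this
    have h0 : ‖a - b‖ ≤ 0 := by
      by_contra hc
      push Not at hc
      nlinarith [mul_pos hA hc]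
    exact sub_eq_zero.mp (norm_le_zero_iff.mp h0)
  · have hopen : IsOpen (Set.range G) := by
      rw [isOpen_iff_mem_nhds]
      rintro _ ⟨y, rfl⟩
      have hinj : Function.Injective (fderiv ℝ G y) := by
        rw [injective_iff_map_eq_zero]
        intro ξ hξ
        have := h y ξ
        rw [hξ] at this
        simp at this
        by_contra hne
        have hp : 0 < ‖ξ‖ := norm_pos_iff.mpr hne
        nlinarith [mul_pos hA (pow_pos hp 2)]
      have hfin : Module.finrank ℝ (Space d) = Module.finrank ℝ (Covector d) :=
        (InnerProductSpace.toDual ℝ (Space d)).toLinearEquiv.finrank_eq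
      let e := (LinearEquiv.ofInjectiveOfFinrankEq
        (fderiv ℝ G y : Space d →ₗ[ℝ] Covector d) hinj hfin).toContinuousLinearEquiv
      have he : (e : Space d →L[ℝ] Covector d) = fderiv ℝ G y := by
        ext v w
        rfl
      have hs : HasStrictFDerivAt G (e : Space d →L[ℝ] Covector d) y := by
        rw [he]
        exact hG.contDiffAt.hasStrictFDerivAt (by norm_num)
      rw [← hs.map_nhds_eq_of_equiv]
      exact Filter.mem_map.mpr (Filter.univ_mem' fun z => Set.mem_range_self z)
    have hclosed : IsClosed (Set.range G) := by
      refine IsSeqClosed.isClosed fun p q hp hq => ?_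
      choose y hy using hp
      have hc : CauchySeq y := by
        rw [Metric.cauchySeq_iff']
        intro ε hε
        obtain ⟨n, hn⟩ := Metric.cauchySeq_iff'.mp hq.cauchySeq (A * ε) (mul_pos hA hε)
        refine ⟨n, fun m hm => ?_⟩
        have h1 := hn m hm
        rw [dist_eq_norm, ← hy, ← hy] at h1
        rw [dist_eq_norm]
        exact lt_of_mul_lt_mul_left ((anti _ _).trans_lt h1) hA.le
      obtain ⟨a, ha⟩ := cauchySeq_tendsto_of_complete hc
      refine ⟨a, tendsto_nhds_unique ((hd.continuous.tendsto a).comp ha) ?_⟩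
      exact hq.congr fun n => (hy n).symm
    exact Set.range_eq_univ.mp
      (IsClopen.eq_univ ⟨hclosed, hopen⟩ ⟨G 0, Set.mem_range_self 0⟩)

namespace GeneratingFunction

variable {d : ℕ} (S : GeneratingFunction d)

theorem partialOne_eq (x y ξ : Space d) :
    partialOne S.toFun x y ξ =
      fderiv ℝ (fun z : Space d × Space d => S.toFun z.1 z.2) (x, y) (ξ, 0) := by
  have h1 : HasFDerivAt (fun x' : Space d => (x', y)) (ContinuousLinearMap.inl ℝ _ _) x :=
    hasFDerivAt_prodMk_left x y
  have h2 := ((S.contDiff.differentiable (by norm_num)) (x, y)).hasFDerivAt.comp x h1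
  have h3 : partialOne S.toFun x y = _ := h2.fderiv
  rw [h3]
  simp

theorem partialTwo_eq (x y ξ : Space d) :
    partialTwo S.toFun x y ξ =
      fderiv ℝ (fun z : Space d × Space d => S.toFun z.1 z.2) (x, y) (0, ξ) := by
  have h1 : HasFDerivAt (fun y' : Space d => (x, y')) (ContinuousLinearMap.inr ℝ _ _) y :=
    hasFDerivAt_prodMk_right x y
  have h2 := ((S.contDiff.differentiable (by norm_num)) (x, y)).hasFDerivAt.comp y h1
  have h3 : partialTwo S.toFun x y = _ := h2.fderiv
  rw [h3]
  simp

theorem contDiff_fderiv :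
    ContDiff ℝ 1 (fderiv ℝ fun z : Space d × Space d => S.toFun z.1 z.2) :=
  S.contDiff.fderiv_right (by norm_num)

theorem contDiff_partialOne (x : Space d) : ContDiff ℝ 1 fun y => partialOne S.toFun x y := by
  have : (fun y => partialOne S.toFun x y) = fun y =>
      (fderiv ℝ (fun z : Space d × Space d => S.toFun z.1 z.2) (x, y)).comp
        (ContinuousLinearMap.inl ℝ (Space d) (Space d)) := by
    ext y ξ
    rw [S.partialOne_eq]
    simp
  rw [this]
  exact (S.contDiff_fderiv.comp (contDiff_const.prodMk contDiff_id)).clm_comp contDiff_const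

theorem contDiff_partialTwo (y : Space d) : ContDiff ℝ 1 fun x => partialTwo S.toFun x y := by
  have : (fun x => partialTwo S.toFun x y) = fun x =>
      (fderiv ℝ (fun z : Space d × Space d => S.toFun z.1 z.2) (x, y)).comp
        (ContinuousLinearMap.inr ℝ (Space d) (Space d)) := by
    ext x ξ
    rw [S.partialTwo_eq]
    simp
  rw [this]
  exact (S.contDiff_fderiv.comp (contDiff_id.prodMk contDiff_const)).clm_comp contDiff_const

theorem fderiv_apply_const {G : Space d → Covector d} (hG : ContDiff ℝ 1 G) (y ξ η : Space d) :
    fderiv ℝ (fun y' => G y' ξ) y η = fderiv ℝ G y η ξ := by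
  have h := ((hG.differentiable (by norm_num)) y).hasFDerivAt.clm_apply
    (hasFDerivAt_const ξ y)
  rw [h.fderiv]
  simp

theorem mixed_symm (x y ξ : Space d) :
    fderiv ℝ (fun x' => partialTwo S.toFun x' y ξ) x ξ =
      fderiv ℝ (fun y' => partialOne S.toFun x y' ξ) y ξ := by
  set D := fderiv ℝ fun z : Space d × Space d => S.toFun z.1 z.2 with hD
  have hd : HasFDerivAt D (fderiv ℝ D (x, y)) (x, y) :=
    ((S.contDiff_fderiv.differentiable (by norm_num)) (x, y)).hasFDerivAt
  have h1 : HasFDerivAt (fun x' : Space d => (x', y)) (ContinuousLinearMap.inl ℝ _ _) x :=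
    hasFDerivAt_prodMk_left x y
  have h2 : HasFDerivAt (fun y' : Space d => (x, y')) (ContinuousLinearMap.inr ℝ _ _) y :=
    hasFDerivAt_prodMk_right x y
  have e1 : (fun x' => partialTwo S.toFun x' y ξ) = fun x' => D (x', y) (0, ξ) := by
    funext x'
    exact S.partialTwo_eq x' y ξ
  have e2 : (fun y' => partialOne S.toFun x y' ξ) = fun y' => D (x, y') (ξ, 0) := by
    funext y'
    exact S.partialOne_eq x y' ξ
  have k1 := (hd.comp x h1).clm_apply (hasFDerivAt_const ((0 : Space d), ξ) x)
  have k2 := (hd.comp y h2).clm_apply (hasFDerivAt_const (ξ, (0 : Space d)) y)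
  have l1 := DFunLike.congr_fun k1.fderiv ξ
  have l2 := DFunLike.congr_fun k2.fderiv ξ
  rw [e1, e2]
  refine Eq.trans l1 (Eq.trans ?_ l2.symm)
  have hsym : fderiv ℝ D (x, y) (ξ, 0) (0, ξ) = fderiv ℝ D (x, y) (0, ξ) (ξ, 0) :=
    (S.contDiff.contDiffAt.isSymmSndFDerivAt (by simp)).eq _ _
  simpa using hsym

theorem bijective_neg_partialOne (x : Space d) :
    Function.Bijective fun y => -partialOne S.toFun x y := by
  obtain ⟨A, hA, h⟩ := S.twist
  refine bijective_of_fderiv_pos (S.contDiff_partialOne x).neg hA fun y ξ => ?_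
  have h1 := h x y ξ
  rw [fderiv_apply_const (S.contDiff_partialOne x)] at h1
  rw [fderiv_fun_neg]
  simp
  linarith

theorem bijective_partialTwo (y : Space d) :
    Function.Bijective fun x => partialTwo S.toFun x y := by
  obtain ⟨A, hA, h⟩ := S.twist
  have hb : Function.Bijective fun x => -partialTwo S.toFun x y := by
    refine bijective_of_fderiv_pos (S.contDiff_partialTwo y).neg hA fun x ξ => ?_
    have h1 := h x y ξ
    rw [← S.mixed_symm, fderiv_apply_const (S.contDiff_partialTwo y)] at h1
    rw [fderiv_fun_neg]
    simp
    linarith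
  have := (Equiv.neg (Covector d)).bijective.comp hb
  simpa [Function.comp_def] using this

/-! ### The twist map -/

/-- `𝓛 : (x,y) ↦ (x, -∂₁S(x,y))`. -/
def legendre : Space d × Space d ≃ Cotangent d :=
  Equiv.ofBijective (fun z => (z.1, -partialOne S.toFun z.1 z.2)) (by
    refine ⟨?_, ?_⟩
    · rintro ⟨x, y⟩ ⟨x', y'⟩ h
      obtain ⟨rfl, h2⟩ := Prod.mk.inj h
      exact Prod.ext rfl ((S.bijective_neg_partialOne x).1 h2)
    · rintro ⟨x, p⟩
      obtain ⟨y, hy⟩ := (S.bijective_neg_partialOne x).2 p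
      exact ⟨(x, y), Prod.ext rfl hy⟩)

/-- `(x,y) ↦ (y, ∂₂S(x,y))`. -/
def legendreEnd : Space d × Space d ≃ Cotangent d :=
  Equiv.ofBijective (fun z => (z.2, partialTwo S.toFun z.1 z.2)) (by
    refine ⟨?_, ?_⟩
    · rintro ⟨x, y⟩ ⟨x', y'⟩ h
      obtain ⟨rfl, h2⟩ := Prod.mk.inj h
      exact Prod.ext ((S.bijective_partialTwo y).1 h2) rfl
    · rintro ⟨y, p⟩
      obtain ⟨x, hx⟩ := (S.bijective_partialTwo y).2 p
      exact ⟨(x, y), Prod.ext rfl hx⟩)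

/-- The lift `F̄` of the twist map to `T*ℝᵈ`; see `lift_eq_iff`. -/
def lift : Equiv.Perm (Cotangent d) := S.legendre.symm.trans S.legendreEnd

/-- The shift `φ` on `ℝᵈ × ℝᵈ`; see `shift_eq_iff`. -/
def shift : Equiv.Perm (Space d × Space d) := S.legendreEnd.trans S.legendre.symm

/-- `F̄(x,p) = (x',p')` iff `p = -∂₁S(x,x')` and `p' = ∂₂S(x,x')`. -/
theorem lift_eq_iff (x x' : Space d) (p p' : Covector d) :
    S.lift (x, p) = (x', p') ↔
      p = -partialOne S.toFun x x' ∧ p' = partialTwo S.toFun x x' := by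
  obtain ⟨⟨a, b⟩, hz⟩ := S.legendre.surjective (x, p)
  have h1 : a = x ∧ -partialOne S.toFun a b = p := Prod.mk.inj hz
  obtain ⟨rfl, rfl⟩ := h1
  have h2 : S.lift (a, -partialOne S.toFun a b) = (b, partialTwo S.toFun a b) := by
    rw [← hz]
    simp [lift]
    rfl
  rw [h2]
  constructor
  · intro h
    obtain ⟨rfl, rfl⟩ := Prod.mk.inj h
    exact ⟨rfl, rfl⟩
  · rintro ⟨h, rfl⟩
    have := (S.bijective_neg_partialOne a).1 h
    rw [this]

/-- `φ(x₀,x₁) = (x₁,x₂)` iff `(x₀,x₁,x₂)` is extremal. -/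
theorem shift_eq_iff (x y y' z : Space d) :
    S.shift (x, y) = (y', z) ↔
      y' = y ∧ partialTwo S.toFun x y + partialOne S.toFun y z = 0 := by
  have h : S.shift (x, y) = (y', z) ↔ S.legendreEnd (x, y) = S.legendre (y', z) :=
    S.legendre.symm_apply_eq
  rw [h]
  change (y, partialTwo S.toFun x y) = (y', -partialOne S.toFun y' z) ↔ _
  rw [Prod.mk.injEq, ← eq_neg_iff_add_eq_zero]
  constructor
  · rintro ⟨rfl, h⟩
    exact ⟨rfl, h⟩
  · rintro ⟨rfl, h⟩
    exact ⟨rfl, h⟩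

/-- The vertical subspace `{0} × (ℝᵈ)*`, the kernel of the differential of `(x,p) ↦ x`. -/
def vertical (d : ℕ) : Submodule ℝ (Cotangent d) :=
  LinearMap.ker (LinearMap.fst ℝ (Space d) (Covector d))

/-- The twist map `F` of `T*𝕋ᵈ` is without conjugate points:
`V(Fⁿ(z)) ∩ DFⁿ(z)·V(z) = {0}` for all `z` and all integers `n ≠ 0`.
It is read in the coordinates `(x,p)` given by the covering `T*ℝᵈ → T*𝕋ᵈ`, where `F` is `F̄`. -/
def WithoutConjugatePoints : Prop :=
  ∀ (z : Cotangent d) (n : ℤ), n ≠ 0 →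
    vertical d ⊓ (vertical d).map
      (fderiv ℝ (fun w => (S.lift ^ n) w) z : Cotangent d →ₗ[ℝ] Cotangent d) = ⊥

/-! ### Translation-invariant orbits -/

/-- `{(x,y) : φᴺ(x,y) = (x+r,y+r)}`. -/
def periodicSet (N : ℕ) (r : Fin d → ℤ) : Set (Space d × Space d) :=
  {z | (S.shift ^ N) z = (z.1 + latticeVec r, z.2 + latticeVec r)}

/-- Its image in `T*ℝᵈ` by `𝓛`. -/
def periodicSetDual (N : ℕ) (r : Fin d → ℤ) : Set (Cotangent d) :=
  S.legendre '' S.periodicSet N r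

/-- The projection to `T*𝕋ᵈ`. -/
def periodicSetTorus (N : ℕ) (r : Fin d → ℤ) : Set (TorusCotangent d) :=
  toTorus '' S.periodicSetDual N r

end GeneratingFunction

/-! ### Aubry sets -/

/-- The action `S(x₀,…,xₙ)`; only the first `n + 1` terms of the sequence `x` matter. -/
def action {d : ℕ} (S : Space d → Space d → ℝ) (x : ℕ → Space d) (n : ℕ) : ℝ :=
  ∑ k ∈ Finset.range n, S (x k) (x (k + 1))

/-- The minimizing holonomic value, `inf liminf (1/n) S(x₀,…,xₙ)` over all sequences. The `liminf`
may be `+∞`, so it is taken in `[-∞,+∞]`; for a generating function the infimum is finite. -/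
def holonomicValue {d : ℕ} (S : Space d → Space d → ℝ) : ℝ :=
  (⨅ x : ℕ → Space d,
    Filter.liminf (fun n : ℕ => ((action S x n / n : ℝ) : EReal)) Filter.atTop).toReal

/-- The Aubry set of `S` in `ℝᵈ × ℝᵈ`. -/
def aubrySet {d : ℕ} (S : Space d → Space d → ℝ) : Set (Space d × Space d) :=
  {z | ∀ ε : ℝ, 0 < ε → ∃ (n : ℕ) (x : ℕ → Space d), 1 ≤ n ∧
    (∃ r : Fin d → ℤ, x n - x 0 = latticeVec r) ∧
    ‖z.1 - x 0‖ < ε ∧ ‖z.2 - x 1‖ < ε ∧ action S x n - n * holonomicValue S < ε}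

/-- `S_u(x,y) = S(x,y) + u(x) - u(y)`. -/
def addPotential {d : ℕ} (S : Space d → Space d → ℝ) (u : Space d → ℝ) :
    Space d → Space d → ℝ :=
  fun x y => S x y + u x - u y

/-! ### The first cohomology of the torus -/

/-- Closed 1-forms of class `C¹` on `𝕋ᵈ`, seen as `ℤᵈ`-periodic closed 1-forms on `ℝᵈ`. -/
def closedForms (d : ℕ) : AddSubgroup (Space d → Covector d) where
  carrier := {ω | ContDiff ℝ 1 ω ∧ (∀ r x, ω (x + latticeVec r) = ω x) ∧
    ∀ x v w, fderiv ℝ ω x v w = fderiv ℝ ω x w v}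
  zero_mem' := ⟨contDiff_const, fun _ _ => rfl, fun x v w => by simp⟩
  add_mem' := by
    rintro a b ⟨ha, ha', ha''⟩ ⟨hb, hb', hb''⟩
    refine ⟨ha.add hb, fun r x => by simp [ha' r x, hb' r x], fun x v w => ?_⟩
    rw [fderiv_add (ha.differentiable (by norm_num) x) (hb.differentiable (by norm_num) x)]
    simp [ha'' x v w, hb'' x v w]
  neg_mem' := by
    rintro a ⟨ha, ha', ha''⟩
    refine ⟨ha.neg, fun r x => by simp [ha' r x], fun x v w => ?_⟩
    rw [fderiv_neg]
    simp [ha'' x v w]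

/-- Exact 1-forms on `𝕋ᵈ`: differentials of `ℤᵈ`-periodic functions of class `C²`. -/
def exactForms (d : ℕ) : AddSubgroup (closedForms d) where
  carrier := {ω | ∃ w : Space d → ℝ, ContDiff ℝ 2 w ∧ (∀ r x, w (x + latticeVec r) = w x) ∧
    (ω : Space d → Covector d) = fderiv ℝ w}
  zero_mem' := ⟨0, contDiff_const, fun _ _ => rfl, by
    funext x
    simp⟩
  add_mem' := by
    rintro a b ⟨f, hf, hf', ha⟩ ⟨g, hg, hg', hb⟩
    refine ⟨f + g, hf.add hg, fun r x => by simp [hf' r x, hg' r x], ?_⟩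
    funext x
    rw [fderiv_add (hf.differentiable (by norm_num) x) (hg.differentiable (by norm_num) x)]
    simp [ha, hb]
  neg_mem' := by
    rintro a ⟨f, hf, hf', ha⟩
    refine ⟨-f, hf.neg, fun r x => by simp [hf' r x], ?_⟩
    funext x
    rw [fderiv_neg]
    simp [ha]

/-- `H¹(𝕋ᵈ,ℝ)`, closed 1-forms modulo exact 1-forms. -/
abbrev Cohomology (d : ℕ) : Type := closedForms d ⧸ exactForms d

/-- The cohomology class of a closed 1-form. -/
def cohomologyClass {d : ℕ} (ω : Space d → Covector d) (hω : ω ∈ closedForms d) : Cohomology d :=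
  QuotientAddGroup.mk (⟨ω, hω⟩ : closedForms d)

namespace GeneratingFunction

variable {d : ℕ} (S : GeneratingFunction d)

/-- The Aubry set of `S_u`, where `u` is a primitive on `ℝᵈ` of any closed 1-form in the
class `c`. It does not depend on the choice of `u`, see `aubrySetClass_eq`. -/
def aubrySetClass (c : Cohomology d) : Set (Space d × Space d) :=
  {z | ∃ (u : Space d → ℝ) (hu : fderiv ℝ u ∈ closedForms d), ContDiff ℝ 2 u ∧
    cohomologyClass (fderiv ℝ u) hu = c ∧ z ∈ aubrySet (addPotential S.toFun u)}

/-- The dual Aubry set of the class `c` in `T*ℝᵈ`, the image of the previous set by `𝓛`. -/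
def dualAubrySet (c : Cohomology d) : Set (Cotangent d) :=
  S.legendre '' S.aubrySetClass c

/-- The projection to `T*𝕋ᵈ`. -/
def dualAubrySetTorus (c : Cohomology d) : Set (TorusCotangent d) :=
  toTorus '' S.dualAubrySet c

end GeneratingFunction

theorem action_addPotential {d : ℕ} (S : Space d → Space d → ℝ) (u : Space d → ℝ)
    (x : ℕ → Space d) (n : ℕ) :
    action (addPotential S u) x n = action S x n + (u (x 0) - u (x n)) := by
  induction n with
  | zero => simp [action]
  | succ n ih =>
    rw [action, Finset.sum_range_succ, ← action, ih, action, action, Finset.sum_range_succ,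
      addPotential]
    ring

/-- A continuous `ℤᵈ`-periodic function is bounded. -/
theorem exists_bound_of_periodic {d : ℕ} {w : Space d → ℝ} (hw : Continuous w)
    (hp : ∀ r x, w (x + latticeVec r) = w x) : ∃ C, ∀ x, |w x| ≤ C := by
  have hK : IsCompact ((WithLp.toLp 2 : (Fin d → ℝ) → Space d) '' Set.Icc 0 1) :=
    isCompact_Icc.image (PiLp.continuous_toLp 2 _)
  obtain ⟨C, hC⟩ := hK.exists_bound_of_continuousOn hw.continuousOn
  refine ⟨C, fun x => ?_⟩
  have hx : x = WithLp.toLp 2 (fun i => Int.fract (x i)) + latticeVec (fun i => ⌊x i⌋) := by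
    ext i
    simp [latticeVec]
  rw [hx, hp]
  refine hC _ ⟨_, ⟨fun i => Int.fract_nonneg _, fun i => (Int.fract_lt_one _).le⟩, rfl⟩

theorem liminf_coe_le {a b : ℕ → ℝ}
    (h : Filter.Tendsto (fun n => b n - a n) Filter.atTop (nhds 0)) :
    Filter.liminf (fun n => (a n : EReal)) Filter.atTop ≤
      Filter.liminf (fun n => (b n : EReal)) Filter.atTop := by
  have h0 : Filter.Tendsto (fun n => ((b n - a n : ℝ) : EReal)) Filter.atTop
      (nhds ((0 : ℝ) : EReal)) := (continuous_coe_real_ereal.tendsto 0).comp h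
  have h1 := h0.liminf_eq
  have h2 := EReal.le_liminf_add (f := Filter.atTop) (u := fun n => (a n : EReal))
    (v := fun n => ((b n - a n : ℝ) : EReal))
  rw [h1] at h2
  have h3 : ((fun n => (a n : EReal)) + fun n => ((b n - a n : ℝ) : EReal)) =
      fun n => (b n : EReal) := by
    funext n
    simp only [Pi.add_apply]
    rw [← EReal.coe_add]
    simp
  rw [h3] at h2
  simpa using h2

/-- Adding a periodic function to the potential does not change the Aubry set. -/
theorem aubrySet_congr {d : ℕ} (S : Space d → Space d → ℝ) {u v w : Space d → ℝ} {C : ℝ}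
    (hw : Continuous w) (hp : ∀ r x, w (x + latticeVec r) = w x)
    (huv : ∀ x, u x = v x + w x + C) :
    aubrySet (addPotential S u) = aubrySet (addPotential S v) := by
  have hact : ∀ x n, action (addPotential S u) x n =
      action (addPotential S v) x n + (w (x 0) - w (x n)) := by
    intro x n
    rw [action_addPotential, action_addPotential, huv, huv]
    ring
  obtain ⟨B, hB⟩ := exists_bound_of_periodic hw hp
  have htend : ∀ x : ℕ → Space d, Filter.Tendsto
      (fun n : ℕ => (w (x 0) - w (x n)) / n) Filter.atTop (nhds 0) := by
    intro x
    have h2B : Filter.Tendsto (fun n : ℕ => (B + B) / (n : ℝ)) Filter.atTop (nhds 0) :=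
      tendsto_const_div_atTop_nhds_zero_nat _
    refine squeeze_zero_norm (fun n => ?_) h2B
    rw [norm_div, Real.norm_eq_abs, Real.norm_natCast]
    gcongr
    exact (abs_sub _ _).trans (add_le_add (hB _) (hB _))
  have hval : holonomicValue (addPotential S u) = holonomicValue (addPotential S v) := by
    unfold holonomicValue
    congr 1
    refine iInf_congr fun x => le_antisymm (liminf_coe_le ?_) (liminf_coe_le ?_)
    · have := (htend x).neg
      rw [neg_zero] at this
      refine this.congr fun n => ?_
      rw [hact]
      ring
    · refine (htend x).congr fun n => ?_
      rw [hact]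
      ring
  have hloop : ∀ x n, (∃ r : Fin d → ℤ, x n - x 0 = latticeVec r) →
      action (addPotential S u) x n = action (addPotential S v) x n := by
    rintro x n ⟨r, hr⟩
    rw [hact, sub_eq_iff_eq_add'.mp hr, hp, sub_self, add_zero]
  ext z
  refine forall_congr' fun ε => imp_congr_right fun _ => exists_congr fun n =>
    exists_congr fun x => and_congr_right fun _ => and_congr_right fun hr => ?_
  rw [hloop x n hr, hval]

/-- The Aubry set of `S_u` only depends on the cohomology class of `du`. -/
theorem GeneratingFunction.aubrySetClass_eq {d : ℕ} (S : GeneratingFunction d)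
    {v : Space d → ℝ} (hv : ContDiff ℝ 2 v) (hc : fderiv ℝ v ∈ closedForms d) :
    S.aubrySetClass (cohomologyClass (fderiv ℝ v) hc) = aubrySet (addPotential S.toFun v) := by
  apply Set.Subset.antisymm
  · rintro z ⟨u, hu, hu2, huc, hz⟩
    obtain ⟨w, hw, hp, h⟩ := QuotientAddGroup.eq.mp huc.symm
    have hzero : ∀ x, fderiv ℝ (fun y => u y - (v y + w y)) x = 0 := by
      intro x
      have du := hu2.differentiable (by norm_num) x
      have dv := hv.differentiable (by norm_num) x
      have dw := hw.differentiable (by norm_num) x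
      rw [fderiv_fun_sub du (dv.fun_add dw), fderiv_fun_add dv dw]
      have hx : -fderiv ℝ v x + fderiv ℝ u x = fderiv ℝ w x := congrFun h x
      rw [← hx]
      abel
    have hdiff : Differentiable ℝ fun y => u y - (v y + w y) :=
      (hu2.differentiable (by norm_num)).sub
        ((hv.differentiable (by norm_num)).add (hw.differentiable (by norm_num)))
    have hconst := is_const_of_fderiv_eq_zero hdiff hzero
    have huv : ∀ x, u x = v x + w x + (u 0 - (v 0 + w 0)) := by
      intro x
      linarith [hconst x 0]
    rw [← aubrySet_congr S.toFun hw.continuous hp huv]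
    exact hz
  · intro z hz
    exact ⟨v, hc, hv, rfl, hz⟩

end

end TwistMap

namespace TwistMap

noncomputable section

namespace GeneratingFunction

variable {d : ℕ} (S : GeneratingFunction d)

/-! ### Joint regularity and periodicity of the partial derivatives -/

/-! The periodic set is invariant under `S.shift` and under lattice translations. Translation
invariance makes the differential of `u` periodic, so `S_u` is again a generating function. As `L`
is injective on each fibre, the graph hypothesis makes the periodic set the graph of a map `f`, with
`∂₁S(x, f x) = -Du(x)`. Shift invariance puts `(f x, f (f x))` in the same set, and the extremality
equation then gives `∂₂S(x, f x) = Du(f x)`. Hence both partial derivatives of `S_u` vanish at every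
`(x, f x)`.

The key is `minimum_of_critical_graph`. The map `f` is differentiable because it is read off the
inverse Legendre map, so by the chain rule `S_u` is constant along its graph. Coercivity and
periodicity give `S_u` a global minimum (`exists_forall_le`). A minimum is critical, hence lies on
the graph, so the graph is exactly the set of minima, with value `m` say.

It remains to compare with the Aubry set. The orbits of `f` have action `m` per step, so the
holonomic value is `m` (`holonomicValue_eq`). Points of the Aubry set have value `m` by continuity
(`eq_of_mem_aubrySet`). Conversely, the orbit of `(x, f x)` closes up modulo the lattice after `N`
steps with action exactly `N m`. -/

theorem contDiff_partialOne_uncurry :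
    ContDiff ℝ 1 fun z : Space d × Space d => partialOne S.toFun z.1 z.2 := by
  have : (fun z : Space d × Space d => partialOne S.toFun z.1 z.2) = fun z =>
      (fderiv ℝ (fun z : Space d × Space d => S.toFun z.1 z.2) z).comp
        (ContinuousLinearMap.inl ℝ (Space d) (Space d)) := by
    ext z ξ
    rw [S.partialOne_eq]
    simp
  rw [this]
  exact S.contDiff_fderiv.clm_comp contDiff_const

theorem contDiff_partialTwo_uncurry :
    ContDiff ℝ 1 fun z : Space d × Space d => partialTwo S.toFun z.1 z.2 := by
  have : (fun z : Space d × Space d => partialTwo S.toFun z.1 z.2) = fun z =>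
      (fderiv ℝ (fun z : Space d × Space d => S.toFun z.1 z.2) z).comp
        (ContinuousLinearMap.inr ℝ (Space d) (Space d)) := by
    ext z ξ
    rw [S.partialTwo_eq]
    simp
  rw [this]
  exact S.contDiff_fderiv.clm_comp contDiff_const

/-- Passes from critical partials to a zero joint differential, so that the chain rule along a curve
or graph kills the derivative whatever its direction. -/
theorem fderiv_eq_zero_iff (x y : Space d) :
    fderiv ℝ (fun z : Space d × Space d => S.toFun z.1 z.2) (x, y) = 0 ↔
      partialOne S.toFun x y = 0 ∧ partialTwo S.toFun x y = 0 := by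
  constructor
  · intro h
    constructor
    · ext1 ξ
      simp [S.partialOne_eq, h]
    · ext1 ξ
      simp [S.partialTwo_eq, h]
  · rintro ⟨h1, h2⟩
    refine ContinuousLinearMap.ext fun ⟨ξ, η⟩ => ?_
    have e : (ξ, η) = (ξ, (0 : Space d)) + ((0 : Space d), η) := by simp
    rw [e, map_add, ← S.partialOne_eq, ← S.partialTwo_eq, h1, h2]
    simp

theorem partialOne_add_latticeVec (s : Fin d → ℤ) (x y : Space d) :
    partialOne S.toFun (x + latticeVec s) (y + latticeVec s) = partialOne S.toFun x y := by
  unfold partialOne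
  rw [← fderiv_comp_add_right]
  simp only [S.periodic]

theorem partialTwo_add_latticeVec (s : Fin d → ℤ) (x y : Space d) :
    partialTwo S.toFun (x + latticeVec s) (y + latticeVec s) = partialTwo S.toFun x y := by
  unfold partialTwo
  rw [← fderiv_comp_add_right]
  simp only [S.periodic]

/-! ### The twist condition along segments, and coercivity -/

/-- With the second argument frozen, moving the first one along `v` decreases `∂₂S · v` at rate at
least `A ‖v‖²`. This compares `∂₂S` with its values on the diagonal, which are bounded by
periodicity. -/
theorem twist_partialTwo : ∃ A : ℝ, 0 < A ∧ ∀ (x v : Space d) (t : ℝ), 0 ≤ t →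
    partialTwo S.toFun (x + t • v) (x + t • v) v + t * (A * ‖v‖ ^ 2) ≤
      partialTwo S.toFun x (x + t • v) v := by
  obtain ⟨A, hA, h⟩ := S.twist
  refine ⟨A, hA, fun x v t ht => ?_⟩
  set y := x + t • v with hy
  let g : ℝ → ℝ := fun s => partialTwo S.toFun (x + s • v) y v + s * (A * ‖v‖ ^ 2)
  have hg : ∀ s, HasDerivAt g
      (fderiv ℝ (fun x' => partialTwo S.toFun x' y v) (x + s • v) v + A * ‖v‖ ^ 2) s := by
    intro s
    have h1 : HasDerivAt (fun s : ℝ => x + s • v) v s := by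
      simpa using ((hasDerivAt_id s).smul_const v).const_add x
    have hd : Differentiable ℝ fun x' => partialTwo S.toFun x' y v :=
      ((S.contDiff_partialTwo y).clm_apply contDiff_const).differentiable (by norm_num)
    have h2 := (hd (x + s • v)).hasFDerivAt.comp_hasDerivAt s h1
    have h3 := (hasDerivAt_id s).mul_const (A * ‖v‖ ^ 2)
    exact (h2.add h3).congr_deriv (by simp)
  have hanti : Antitone g := antitone_of_hasDerivAt_nonpos hg fun s => by
    have := h (x + s • v) y v
    -- The twist condition differentiates `∂₁S` in `y`; symmetry of the second derivative turns it
    -- into a bound on the `x`-derivative of `∂₂S`.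
    rw [← S.mixed_symm] at this
    simp only [Pi.zero_apply]
    linarith
  have := hanti ht
  simpa [g, ← hy] using this

/-- A generating function is bounded below by a coercive quadratic function of `‖y - x‖`. -/
theorem exists_quadratic_lower_bound : ∃ A B C : ℝ, 0 < A ∧ ∀ x y : Space d,
    A * ‖y - x‖ ^ 2 - B * ‖y - x‖ - C ≤ S.toFun x y := by
  obtain ⟨A, hA, h⟩ := S.twist_partialTwo
  obtain ⟨C, hC⟩ := exists_bound_of_periodic (w := fun x : Space d => S.toFun x x)
    (S.contDiff.continuous.comp (continuous_id.prodMk continuous_id))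
    fun s x => S.periodic s x x
  obtain ⟨B, hB⟩ := exists_bound_of_periodic
    (w := fun x : Space d => ‖partialTwo S.toFun x x‖)
    (S.contDiff_partialTwo_uncurry.continuous.comp (continuous_id.prodMk continuous_id)).norm
    fun s x => by rw [S.partialTwo_add_latticeVec]
  refine ⟨A / 2, B, C, by positivity, fun x y => ?_⟩
  set v := y - x with hv
  -- The difference between `S` and the expected quadratic bound along the segment from the diagonal
  -- point `(x, x)` to `(x, y)`. It is nondecreasing for `0 ≤ t ≤ 1`, and `C` bounds its value at `t
  -- = 0`.
  let g : ℝ → ℝ := fun t => S.toFun x (x + t • v) - t ^ 2 * (A / 2 * ‖v‖ ^ 2) + t * (B * ‖v‖)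
  have hg : ∀ t, HasDerivAt g
      (partialTwo S.toFun x (x + t • v) v - 2 * t * (A / 2 * ‖v‖ ^ 2) + B * ‖v‖) t := by
    intro t
    have h1 : HasDerivAt (fun s : ℝ => x + s • v) v t := by
      simpa using ((hasDerivAt_id t).smul_const v).const_add x
    have hd : Differentiable ℝ fun y' => S.toFun x y' :=
      (S.contDiff.comp (contDiff_const.prodMk contDiff_id)).differentiable (by norm_num)
    have h2 := (hd (x + t • v)).hasFDerivAt.comp_hasDerivAt t h1
    have h3 := (hasDerivAt_pow 2 t).mul_const (A / 2 * ‖v‖ ^ 2)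
    have h4 := (hasDerivAt_id t).mul_const (B * ‖v‖)
    exact ((h2.sub h3).add h4).congr_deriv (by simp [partialTwo])
  have hmono : MonotoneOn g (Set.Icc 0 1) := by
    refine monotoneOn_of_hasDerivWithinAt_nonneg (convex_Icc 0 1)
      (fun t _ => (hg t).continuousAt.continuousWithinAt)
      (fun t _ => (hg t).hasDerivWithinAt) fun t ht => ?_
    rw [interior_Icc] at ht
    have h1 := h x v t ht.1.le
    have h2 : -(B * ‖v‖) ≤ partialTwo S.toFun (x + t • v) (x + t • v) v := by
      have h3 := (partialTwo S.toFun (x + t • v) (x + t • v)).le_opNorm v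
      have h4 := (le_abs_self _).trans (hB (x + t • v))
      rw [Real.norm_eq_abs] at h3
      have h5 := mul_le_mul_of_nonneg_right h4 (norm_nonneg v)
      linarith [neg_abs_le (partialTwo S.toFun (x + t • v) (x + t • v) v)]
    linarith
  have h01 := hmono (Set.left_mem_Icc.mpr zero_le_one) (Set.right_mem_Icc.mpr zero_le_one)
    zero_le_one
  have hx := neg_le_of_abs_le (hC x)
  simp only [g, zero_smul, one_smul, add_zero, hv, add_sub_cancel] at h01
  rw [hv]
  linarith

/-- A generating function attains its minimum. -/
theorem exists_forall_le : ∃ a b : Space d, ∀ x y, S.toFun a b ≤ S.toFun x y := by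
  obtain ⟨A, B, C, hA, h⟩ := S.exists_quadratic_lower_bound
  set m := S.toFun 0 0 with hm
  obtain ⟨R, hR0, hR⟩ : ∃ R : ℝ, 0 ≤ R ∧ ∀ t, R < t → m < A * t ^ 2 - B * t - C := by
    -- Beyond this radius `t > 1` and `A t > |B| + |C| + |m|`; multiplying the latter by `t`
    -- dominates `B t + C + m`.
    refine ⟨1 + (|B| + |C| + |m|) / A, by positivity, fun t ht => ?_⟩
    have h1 : 1 < t := lt_of_le_of_lt (by
      have : 0 ≤ (|B| + |C| + |m|) / A := by positivity
      linarith) ht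
    have h2 : |B| + |C| + |m| < A * t := by
      have : (|B| + |C| + |m|) / A < t := by linarith
      rw [div_lt_iff₀ hA] at this
      linarith
    nlinarith [le_abs_self B, le_abs_self C, le_abs_self m, abs_nonneg C, abs_nonneg m,
      mul_lt_mul_of_pos_right h2 (zero_lt_one.trans h1)]
  set Q : Set (Space d) := (WithLp.toLp 2 : (Fin d → ℝ) → Space d) '' Set.Icc 0 1
  have hQ : IsCompact Q := isCompact_Icc.image (PiLp.continuous_toLp 2 _)
  -- Pairs with base point in the unit cube and displacement at most `R`: up to translation these
  -- are all pairs where `S` can be as small as `S(0, 0)`.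
  set K : Set (Space d × Space d) :=
    (fun z : Space d × Space d => (z.1, z.1 + z.2)) '' (Q ×ˢ Metric.closedBall 0 R)
  have hK : IsCompact K := (hQ.prod (isCompact_closedBall 0 R)).image (by fun_prop)
  have h0 : ((0 : Space d), (0 : Space d)) ∈ K :=
    ⟨(0, 0), ⟨⟨0, ⟨le_rfl, zero_le_one⟩, rfl⟩, by simpa using hR0⟩, by simp⟩
  obtain ⟨⟨a, b⟩, -, hab⟩ := hK.exists_isMinOn ⟨_, h0⟩ S.contDiff.continuous.continuousOn
  refine ⟨a, b, fun x y => ?_⟩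
  by_cases hxy : ‖y - x‖ ≤ R
  · set s : Fin d → ℤ := fun i => -⌊x i⌋ with hs
    have hx : x + latticeVec s = WithLp.toLp 2 (fun i => Int.fract (x i)) := by
      ext i
      simp only [hs, latticeVec, PiLp.add_apply, Int.cast_neg, Int.fract]
      ring
    rw [← S.periodic s x y]
    refine hab (a := (x + latticeVec s, y + latticeVec s))
      ⟨(x + latticeVec s, y - x), ⟨?_, by simpa using hxy⟩, ?_⟩
    · rw [hx]
      exact ⟨_, ⟨fun i => Int.fract_nonneg _, fun i => (Int.fract_lt_one _).le⟩, rfl⟩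
    · refine Prod.ext rfl ?_
      dsimp only
      abel
  · exact (hab h0).trans (((hR _ (not_le.mp hxy)).le).trans (h x y))

/-! ### Differentiability of the inverse Legendre map -/

/-- The derivative of `L` is block triangular, with identity and `-∂₁₂S` on the diagonal, and the
twist condition makes the latter injective. The inverse function theorem then applies at every
point. -/
theorem differentiable_legendre_symm : Differentiable ℝ S.legendre.symm := by
  intro p
  obtain ⟨⟨x, y⟩, rfl⟩ := S.legendre.surjective p
  obtain ⟨A, hA, htw⟩ := S.twist
  have hP := S.contDiff_partialOne_uncurry
  have hPd := ((hP.differentiable (by norm_num)) (x, y)).hasFDerivAt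
  have hL : ContDiff ℝ 1 S.legendre := contDiff_fst.prodMk hP.neg
  set D := fderiv ℝ S.legendre (x, y) with hD
  have hDeq : D = (ContinuousLinearMap.fst ℝ (Space d) (Space d)).prod
      (-fderiv ℝ (fun z : Space d × Space d => partialOne S.toFun z.1 z.2) (x, y)) :=
    (hasFDerivAt_fst.prodMk hPd.neg).fderiv
  have hinj : Function.Injective D := by
    rw [injective_iff_map_eq_zero]
    rintro ⟨ξ, η⟩ hξ
    rw [hDeq] at hξ
    obtain ⟨h1, h2⟩ := Prod.mk.inj hξ
    have h1 : ξ = 0 := h1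
    subst h1
    have h2 : fderiv ℝ (fun z : Space d × Space d => partialOne S.toFun z.1 z.2) (x, y)
        (0, η) = 0 := by simpa using h2
    have h3 := htw x y η
    rw [fderiv_apply_const (S.contDiff_partialOne x)] at h3
    have h4 : HasFDerivAt (fun y' : Space d => (x, y')) (ContinuousLinearMap.inr ℝ _ _) y :=
      hasFDerivAt_prodMk_right x y
    have h5 : fderiv ℝ (fun y' => partialOne S.toFun x y') y = _ := (hPd.comp y h4).fderiv
    rw [h5] at h3
    simp only [ContinuousLinearMap.comp_apply, ContinuousLinearMap.inr_apply, h2,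
      zero_apply] at h3
    have h6 : ‖η‖ = 0 := by
      by_contra hne
      have hp : 0 < ‖η‖ := lt_of_le_of_ne (norm_nonneg _) (Ne.symm hne)
      nlinarith [mul_pos hA (pow_pos hp 2)]
    rw [norm_eq_zero.mp h6]
    rfl
  have hfin : Module.finrank ℝ (Space d × Space d) = Module.finrank ℝ (Cotangent d) := by
    rw [Module.finrank_prod, Module.finrank_prod,
      (InnerProductSpace.toDual ℝ (Space d)).toLinearEquiv.finrank_eq]
  let e := (LinearEquiv.ofInjectiveOfFinrankEq
    (D : Space d × Space d →ₗ[ℝ] Cotangent d) hinj hfin).toContinuousLinearEquiv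
  have he : (e : Space d × Space d →L[ℝ] Cotangent d) = D :=
    ContinuousLinearMap.ext fun _ => rfl
  have hs : HasStrictFDerivAt S.legendre (e : Space d × Space d →L[ℝ] Cotangent d) (x, y) := by
    rw [he]
    exact hL.contDiffAt.hasStrictFDerivAt (by norm_num)
  -- A local right inverse of a bijection is its global inverse.
  refine (hs.to_localInverse.hasFDerivAt.congr_of_eventuallyEq ?_).differentiableAt
  filter_upwards [hs.eventually_right_inverse] with q hq
  rw [Equiv.symm_apply_eq, hq]

/-! ### Generating functions with a graph of critical points -/

/-- If every `(x, f x)` is a critical point of a generating function, these points are exactly its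
minima. -/
theorem minimum_of_critical_graph {f : Space d → Space d}
    (h1 : ∀ x, partialOne S.toFun x (f x) = 0) (h2 : ∀ x, partialTwo S.toFun x (f x) = 0) :
    ∃ m, (∀ x y, m ≤ S.toFun x y) ∧ ∀ x y, S.toFun x y = m ↔ y = f x := by
  have hf : ∀ x y, partialOne S.toFun x y = 0 → y = f x := fun x y h =>
    (S.bijective_neg_partialOne x).1 (by simp [h, h1])
  obtain ⟨a, b, hab⟩ := S.exists_forall_le
  have hmin : ∀ x y, S.toFun x y = S.toFun a b → y = f x := by
    intro x y h
    -- Minimality in the first variable alone suffices, since `∂₁S(x, y) = 0` determines `y`.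
    refine hf x y (IsLocalMin.fderiv_eq_zero (Filter.Eventually.of_forall fun x' => ?_))
    exact h.trans_le (hab x' y)
  -- The graph of `f` is the preimage of the zero section under `L`, so `f` inherits
  -- differentiability without any assumption on it.
  have hsymm : ∀ x, S.legendre.symm (x, 0) = (x, f x) := by
    intro x
    rw [Equiv.symm_apply_eq]
    exact Prod.ext rfl (neg_eq_zero.mpr (h1 x)).symm
  have hconst : ∀ x, S.toFun x (f x) = S.toFun a (f a) := by
    have hG : Differentiable ℝ fun x : Space d => (x, f x) := by
      simp_rw [← hsymm]
      exact S.differentiable_legendre_symm.comp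
        (differentiable_id.prodMk (differentiable_const (0 : Covector d)))
    have hW : Differentiable ℝ fun z : Space d × Space d => S.toFun z.1 z.2 :=
      S.contDiff.differentiable (by norm_num)
    intro x
    refine is_const_of_fderiv_eq_zero (f := fun x => S.toFun x (f x)) (hW.comp hG)
      (fun x => ?_) x a
    have h := ((hW (x, f x)).hasFDerivAt.comp x (hG x).hasFDerivAt).fderiv
    rw [(S.fderiv_eq_zero_iff x (f x)).mpr ⟨h1 x, h2 x⟩, ContinuousLinearMap.zero_comp] at h
    exact h
  refine ⟨S.toFun a b, hab, fun x y => ⟨hmin x y, ?_⟩⟩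
  rintro rfl
  rw [hconst, ← hmin a b rfl]

/-! ### Invariance of the set of translation-invariant orbits -/

theorem shift_add_latticeVec (s : Fin d → ℤ) (z : Space d × Space d) :
    S.shift (z + (latticeVec s, latticeVec s)) = S.shift z + (latticeVec s, latticeVec s) := by
  obtain ⟨x, y⟩ := z
  rcases hz : S.shift (x, y) with ⟨y', w⟩
  obtain ⟨rfl, h⟩ := (S.shift_eq_iff x y y' w).mp hz
  refine (S.shift_eq_iff _ _ _ _).mpr ⟨rfl, ?_⟩
  rw [S.partialOne_add_latticeVec, S.partialTwo_add_latticeVec, h]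

theorem shift_pow_add_latticeVec (N : ℕ) (s : Fin d → ℤ) (z : Space d × Space d) :
    (S.shift ^ N) (z + (latticeVec s, latticeVec s)) =
      (S.shift ^ N) z + (latticeVec s, latticeVec s) := by
  induction N with
  | zero => rfl
  | succ N ih => rw [pow_succ', Equiv.Perm.mul_apply, ih, shift_add_latticeVec,
      Equiv.Perm.mul_apply]

theorem mem_periodicSet_iff {N : ℕ} {r : Fin d → ℤ} {z : Space d × Space d} :
    z ∈ S.periodicSet N r ↔ (S.shift ^ N) z = z + (latticeVec r, latticeVec r) :=
  Iff.rfl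

variable {S} {N : ℕ} {r : Fin d → ℤ}

theorem shift_mem_periodicSet {z : Space d × Space d} (hz : z ∈ S.periodicSet N r) :
    S.shift z ∈ S.periodicSet N r := by
  rw [mem_periodicSet_iff] at hz ⊢
  rw [← Equiv.Perm.mul_apply, ← pow_succ, pow_succ', Equiv.Perm.mul_apply, hz,
    shift_add_latticeVec]

theorem shift_pow_mem_periodicSet {z : Space d × Space d} (hz : z ∈ S.periodicSet N r) (k : ℕ) :
    (S.shift ^ k) z ∈ S.periodicSet N r := by
  induction k with
  | zero => exact hz
  | succ k ih =>
    rw [pow_succ', Equiv.Perm.mul_apply]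
    exact shift_mem_periodicSet ih

theorem add_latticeVec_mem_periodicSet {z : Space d × Space d} (hz : z ∈ S.periodicSet N r)
    (s : Fin d → ℤ) : z + (latticeVec s, latticeVec s) ∈ S.periodicSet N r := by
  rw [mem_periodicSet_iff] at hz ⊢
  rw [shift_pow_add_latticeVec, hz, add_right_comm]

theorem shift_snd_fst (z : Space d × Space d) : (S.shift z).1 = z.2 :=
  ((S.shift_eq_iff z.1 z.2 _ _).mp rfl).1

/-! ### Adding a potential -/

variable {u : Space d → ℝ}

/-- A function with periodic differential need not be periodic, but its increments under a lattice
translation are constant. This is enough for `u x - u y` to be invariant under the diagonal action.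
-/
theorem sub_periodic_of_fderiv_periodic (hu : Differentiable ℝ u)
    (hp : ∀ (s : Fin d → ℤ) x, fderiv ℝ u (x + latticeVec s) = fderiv ℝ u x)
    (s : Fin d → ℤ) (x y : Space d) :
    u (x + latticeVec s) - u x = u (y + latticeVec s) - u y := by
  have hd : Differentiable ℝ fun x => u (x + latticeVec s) :=
    hu.comp (differentiable_id.add_const _)
  refine is_const_of_fderiv_eq_zero (f := fun x => u (x + latticeVec s) - u x) (hd.sub hu)
    (fun x => ?_) x y
  rw [fderiv_fun_sub (hd x) (hu x), fderiv_comp_add_right, hp, sub_self]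

theorem partialOne_addPotential (hu : Differentiable ℝ u) (x y : Space d) :
    partialOne (addPotential S.toFun u) x y = partialOne S.toFun x y + fderiv ℝ u x := by
  have hd : Differentiable ℝ fun x' => S.toFun x' y :=
    (S.contDiff.comp (contDiff_id.prodMk contDiff_const)).differentiable (by norm_num)
  exact (((hd x).hasFDerivAt.add (hu x).hasFDerivAt).sub_const (u y)).fderiv

theorem partialTwo_addPotential (hu : Differentiable ℝ u) (x y : Space d) :
    partialTwo (addPotential S.toFun u) x y = partialTwo S.toFun x y - fderiv ℝ u y := by
  have hd : Differentiable ℝ fun y' => S.toFun x y' :=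
    (S.contDiff.comp (contDiff_const.prodMk contDiff_id)).differentiable (by norm_num)
  exact (((hd y).hasFDerivAt.add_const (u x)).sub (hu y).hasFDerivAt).fderiv

/-- `S_u` is a generating function when `Du` is periodic. -/
def withPotential (S : GeneratingFunction d) (hu : ContDiff ℝ 2 u)
    (hp : ∀ (s : Fin d → ℤ) x, fderiv ℝ u (x + latticeVec s) = fderiv ℝ u x) :
    GeneratingFunction d where
  toFun := addPotential S.toFun u
  contDiff := (S.contDiff.add (hu.comp contDiff_fst)).sub (hu.comp contDiff_snd)
  periodic s x y := by
    have := sub_periodic_of_fderiv_periodic (hu.differentiable (by norm_num)) hp s x y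
    simp only [addPotential, S.periodic]
    linarith
  twist := by
    obtain ⟨A, hA, h⟩ := S.twist
    refine ⟨A, hA, fun x y ξ => ?_⟩
    simp only [partialOne_addPotential (hu.differentiable (by norm_num)),
      add_apply, fderiv_add_const]
    exact h x y ξ

end GeneratingFunction

/-! ### Aubry sets of functions bounded below -/

variable {d : ℕ} {W : Space d → Space d → ℝ} {m : ℝ}

theorem mul_le_action (h : ∀ x y, m ≤ W x y) (x : ℕ → Space d) (n : ℕ) :
    n * m ≤ action W x n := by
  simpa [action] using Finset.card_nsmul_le_sum (Finset.range n) _ m fun k _ => h (x k) (x (k + 1))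

theorem action_eq_mul {x : ℕ → Space d} (h : ∀ k, W (x k) (x (k + 1)) = m) (n : ℕ) :
    action W x n = n * m := by
  simp [action, h]

/-- The holonomic value of a function which attains its minimum along a whole orbit. -/
theorem holonomicValue_eq (h : ∀ x y, m ≤ W x y) {x : ℕ → Space d}
    (hx : ∀ k, W (x k) (x (k + 1)) = m) : holonomicValue W = m := by
  have key : (⨅ x : ℕ → Space d,
      Filter.liminf (fun n : ℕ => ((action W x n / n : ℝ) : EReal)) Filter.atTop) = (m : EReal) := by
    apply le_antisymm
    · refine (iInf_le _ x).trans (le_of_eq ?_)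
      refine Filter.Tendsto.liminf_eq (tendsto_const_nhds.congr' ?_)
      filter_upwards [Filter.eventually_gt_atTop 0] with n hn
      have : (n : ℝ) ≠ 0 := by positivity
      rw [action_eq_mul hx, mul_div_cancel_left₀ _ this]
    · refine le_iInf fun x => Filter.le_liminf_of_le (by isBoundedDefault) ?_
      filter_upwards [Filter.eventually_gt_atTop 0] with n hn
      have : (0 : ℝ) < n := by positivity
      rw [EReal.coe_le_coe_iff, le_div_iff₀ this, mul_comm]
      exact mul_le_action h x n
  rw [holonomicValue, key, EReal.toReal_coe]

/-- On its Aubry set a continuous function bounded below by its holonomic value attains it. -/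
theorem eq_of_mem_aubrySet (hW : Continuous fun z : Space d × Space d => W z.1 z.2)
    (h : ∀ x y, m ≤ W x y) (hm : holonomicValue W = m) {z : Space d × Space d}
    (hz : z ∈ aubrySet W) : W z.1 z.2 = m := by
  refine le_antisymm (le_of_forall_pos_le_add fun δ hδ => ?_) (h _ _)
  -- Half of `δ` pays for replacing `z` by `(x 0, x 1)`, half for the excess action; the remaining
  -- steps each cost at least `m`, so the whole excess bounds that of the first step.
  obtain ⟨ε, hε, hc⟩ := Metric.continuous_iff.mp hW z (δ / 2) (by positivity)
  obtain ⟨n, x, hn, -, h0, h1, hact⟩ := hz (min ε (δ / 2)) (by positivity)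
  rw [hm] at hact
  obtain ⟨k, rfl⟩ := Nat.exists_eq_add_of_le' hn
  have h2 : W (x 0) (x 1) + k * m ≤ action W x (k + 1) := by
    rw [action, Finset.sum_range_succ', add_comm]
    gcongr
    exact mul_le_action h (fun i => x (i + 1)) k
  have h3 := hc (x 0, x 1) (by
    rw [Prod.dist_eq, dist_comm, dist_comm (x 1), dist_eq_norm, dist_eq_norm]
    exact max_lt (h0.trans_le (min_le_left _ _)) (h1.trans_le (min_le_left _ _)))
  rw [Real.dist_eq] at h3
  have h4 := (abs_lt.mp h3).1
  have h5 := hact.trans_le (min_le_right _ _)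
  push_cast at h5
  dsimp only at h4
  linarith

/-! ### Identification of the periodic set with the Aubry set -/

theorem GeneratingFunction.periodicSet_eq_aubrySet (S : GeneratingFunction d) {N : ℕ} (hN : 1 ≤ N)
    {r : Fin d → ℤ} {u : Space d → ℝ} (hu : ContDiff ℝ 2 u)
    (hp : ∀ (s : Fin d → ℤ) x, fderiv ℝ u (x + latticeVec s) = fderiv ℝ u x)
    (hgraph : S.periodicSetDual N r = Set.range fun x => (x, fderiv ℝ u x)) :
    S.periodicSet N r = aubrySet (addPotential S.toFun u) := by
  have hud : Differentiable ℝ u := hu.differentiable (by norm_num)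
  have hmem : ∀ x y, (x, y) ∈ S.periodicSet N r ↔ -partialOne S.toFun x y = fderiv ℝ u x := by
    intro x y
    rw [← S.legendre.injective.mem_set_image]
    change (x, -partialOne S.toFun x y) ∈ S.periodicSetDual N r ↔ _
    simp only [hgraph, Set.mem_range, Prod.mk.injEq, exists_eq_left]
    exact eq_comm
  choose f hf using fun x => (S.bijective_neg_partialOne x).2 (fderiv ℝ u x)
  have hfmem : ∀ x, (x, f x) ∈ S.periodicSet N r := fun x => (hmem _ _).mpr (hf x)
  have hfuniq : ∀ x y, (x, y) ∈ S.periodicSet N r ↔ y = f x := fun x y => by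
    refine ⟨fun h => (S.bijective_neg_partialOne x).1 (((hmem x y).mp h).trans (hf x).symm), ?_⟩
    rintro rfl
    exact hfmem x
  set W := S.withPotential hu hp
  obtain ⟨m, hle, heq⟩ := W.minimum_of_critical_graph (f := f)
    (fun x => by
      refine (partialOne_addPotential hud x (f x)).trans ?_
      rw [← hf x]
      exact add_neg_cancel _)
    (fun x => by
      rcases hz : S.shift (x, f x) with ⟨y', z⟩
      obtain ⟨rfl, h⟩ := (S.shift_eq_iff _ _ _ _).mp hz
      -- Shift invariance places the next pair of the orbit on the graph too, which evaluates `∂₁S`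
      -- there as `-Du(f x)`; extremality transfers this to `∂₂S(x, f x)`.
      have hz' := shift_mem_periodicSet (hfmem x)
      rw [hz, hmem] at hz'
      refine (partialTwo_addPotential hud x (f x)).trans ?_
      rw [← hz', sub_neg_eq_add, h])
  have hval : holonomicValue W.toFun = m :=
    holonomicValue_eq hle (x := fun k => f^[k] 0) fun k => by
      rw [heq, Function.iterate_succ_apply']
  ext ⟨x, y⟩
  rw [hfuniq, ← heq]
  refine ⟨fun h ε hε => ?_, fun h => eq_of_mem_aubrySet (z := (x, y)) W.contDiff.continuous hle hval h⟩
  rw [heq] at h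
  subst h
  -- Consecutive terms of `q` form the pair `φᵏ(x, f x)`, so every step lies on the graph, and `q N`
  -- is `x` translated by `r`.
  set q : ℕ → Space d := fun k => ((S.shift ^ k) (x, f x)).1 with hq
  have hstep : ∀ k, W.toFun (q k) (q (k + 1)) = m := by
    intro k
    rw [heq, ← hfuniq]
    have h2 : q (k + 1) = ((S.shift ^ k) (x, f x)).2 := by
      rw [hq]
      dsimp only
      rw [pow_succ', Equiv.Perm.mul_apply, shift_snd_fst]
    rw [h2]
    exact shift_pow_mem_periodicSet (hfmem x) k
  have hq1 : q 1 = f x := by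
    rw [hq]
    dsimp only
    rw [pow_one, shift_snd_fst]
  refine ⟨N, q, hN, ⟨r, ?_⟩, by simpa [hq] using hε, by simpa [hq1] using hε, ?_⟩
  · have := congrArg Prod.fst (hfmem x : (S.shift ^ N) (x, f x) = _)
    simp [hq, this]
  · have h1 : action (addPotential S.toFun u) q N = N * m := action_eq_mul hstep N
    have h2 : holonomicValue (addPotential S.toFun u) = m := hval
    rw [h1, h2, sub_self]
    exact hε

/-- `Du` is periodic when its graph is the set of translation-invariant orbits. -/
theorem GeneratingFunction.fderiv_periodic_of_graph {S : GeneratingFunction d} {N : ℕ}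
    {r : Fin d → ℤ} {u : Space d → ℝ}
    (hgraph : S.periodicSetDual N r = Set.range fun x => (x, fderiv ℝ u x))
    (s : Fin d → ℤ) (x : Space d) : fderiv ℝ u (x + latticeVec s) = fderiv ℝ u x := by
  have hx : (x, fderiv ℝ u x) ∈ S.periodicSetDual N r := hgraph ▸ Set.mem_range_self x
  obtain ⟨⟨a, b⟩, hz, hab⟩ := hx
  obtain ⟨rfl, hb⟩ : a = x ∧ -partialOne S.toFun a b = fderiv ℝ u x := Prod.mk.inj hab
  have h : (a + latticeVec s, -partialOne S.toFun (a + latticeVec s) (b + latticeVec s)) ∈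
      S.periodicSetDual N r :=
    ⟨_, add_latticeVec_mem_periodicSet hz s, rfl⟩
  rw [hgraph, S.partialOne_add_latticeVec, hb] at h
  obtain ⟨y, hy⟩ := h
  obtain ⟨rfl, hy⟩ := Prod.mk.inj hy
  exact hy

end

end TwistMap

theorem proposition5p1 (d : ℕ) (hd : 1 ≤ d) (S : TwistMap.GeneratingFunction d)
    (hS : S.WithoutConjugatePoints) (N : ℕ) (hN : 1 ≤ N) (r : Fin d → ℤ)
    (u : TwistMap.Space d → ℝ) (hu : ContDiff ℝ 2 u)
    (hgraph : S.periodicSetDual N r = Set.range fun x => (x, fderiv ℝ u x)) :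
    ∃ hc : fderiv ℝ u ∈ TwistMap.closedForms d,
      S.periodicSetTorus N r =
        S.dualAubrySetTorus (TwistMap.cohomologyClass (fderiv ℝ u) hc) := by
  have hp := TwistMap.GeneratingFunction.fderiv_periodic_of_graph hgraph
  have hc : fderiv ℝ u ∈ TwistMap.closedForms d :=
    ⟨hu.fderiv_right (by norm_num), hp, fun x v w =>
      (hu.contDiffAt.isSymmSndFDerivAt (by simp)).eq v w⟩
  refine ⟨hc, ?_⟩
  rw [TwistMap.GeneratingFunction.periodicSetTorus, TwistMap.GeneratingFunction.dualAubrySetTorus,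
    TwistMap.GeneratingFunction.periodicSetDual, TwistMap.GeneratingFunction.dualAubrySet,
    S.aubrySetClass_eq hu hc, S.periodicSet_eq_aubrySet hN hu hp hgraph]
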